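/- Let $\mathrm{GL}^+(2)=\{F\in\mathbb R^{2\times2}:\det F>0\}$ and let $W\colon \mathrm{GL}^+(2)\to\mathbb R$ be an objective-isotropic function of class $C^2$ with additive volumetric-isochoric split, i.e. $$W(F)=h\Big(\frac{\lambda_1}{\lambda_2}\Big)+f(\lambda_1\lambda_2)\qquad\text{for all }F\in \mathrm{GL}^+(2),$$ where $\lambda_1,\lambda_2>0$ are the singular values of $F$, $h,f\in C^2((0,\infty),\mathbb R)$, and $h(t)=h(1/t)$ for all $t\in(0,\infty)$. Let $$h_0=\inf_{t\in(0,\infty)}t^2h''(t)\in[-\infty,\infty),\qquad f_0=\inf_{z\in(0,\infty)}z^2f''(z)\in[-\infty,\infty),$$ and for $t\in(0,\infty)$ put $$a(t)=t^2(t^2-1)h'(t)h''(t)-2t\,h'(t)^2,\qquad b(t)=(t^2+3)h'(t)+2t(t^2+1)h''(t),\qquad c(t)=4t\big(h'(t)+t\,h''(t)\big).$$ Call $W$ rank-one convex if for all $F\in \mathrm{GL}^+(2)$ and $\xi,\eta\in\mathbb R^2$ the function $s\mapsto W(F+s\,\xi\otimes\eta)$ is convex on the interval $\{s\in\mathbb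 R:\det(F+s\,\xi\otimes\eta)>0\}$. Then $W$ is rank-one convex if and only if all of the following conditions hold: 1. $h_0$ and $f_0$ are finite and $h_0+f_0\ge 0$; 2. $h'(t)\ge0$ for all $t\ge1$; 3. for all $t\in(0,\infty)$ with $t\ne1$: $\ \frac{2t}{t-1}h'(t)-t^2h''(t)+f_0\ge0\ $ or $\ a(t)+[b(t)-c(t)]f_0\ge0$; 4. for all $t\in(0,\infty)$: $\ \frac{2t}{t+1}h'(t)+t^2h''(t)-f_0\ge0\ $ or $\ a(t)+[b(t)+c(t)]f_0\ge0$. -/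

import Mathlib

open Set

attribute [local instance] Matrix.frobeniusNormedAddCommGroup Matrix.frobeniusNormedSpace

noncomputable section

namespace VolIso

/-- The set `GL⁺(2)` of real `2 × 2` matrices with positive determinant. -/
def GLp2 : Set (Matrix (Fin 2) (Fin 2) ℝ) := {F | 0 < F.det}

/-- The (larger) first singular value of `F`, where `F` acts on Euclidean `ℝ²`. -/
def sv₁ (F : Matrix (Fin 2) (Fin 2) ℝ) : ℝ :=
  (Matrix.toEuclideanLin F).singularValues 0

/-- The (smaller) second singular value of `F`, where `F` acts on Euclidean `ℝ²`. -/
def sv₂ (F : Matrix (Fin 2) (Fin 2) ℝ) : ℝ :=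
  (Matrix.toEuclideanLin F).singularValues 1

/-- Rank-one convexity on `GL⁺(2)`: `W` is convex along every line `s ↦ F + s ξ ⊗ η`, on the set
of those `s` for which the line stays in `GL⁺(2)`. This set is an interval, since
`det (F + s ξ ⊗ η)` is affine in `s`. -/
def RankOneConvex (W : Matrix (Fin 2) (Fin 2) ℝ → ℝ) : Prop :=
  ∀ F ∈ GLp2, ∀ ξ η : Fin 2 → ℝ,
    ConvexOn ℝ {s : ℝ | F + s • Matrix.vecMulVec ξ η ∈ GLp2}
      (fun s : ℝ => W (F + s • Matrix.vecMulVec ξ η))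

/-- The set of values `t² u''(t)`, `t ∈ (0,∞)`. -/
def sqDerivValues (u : ℝ → ℝ) : Set ℝ :=
  (fun t : ℝ => t ^ 2 * deriv (deriv u) t) '' Ioi 0

/-- `inf_{t ∈ (0,∞)} t² u''(t)`, a real number which is meaningful if the set of values is bounded
below. -/
def sqDerivInf (u : ℝ → ℝ) : ℝ := sInf (sqDerivValues u)

def coeffA (h : ℝ → ℝ) (t : ℝ) : ℝ :=
  t ^ 2 * (t ^ 2 - 1) * deriv h t * deriv (deriv h) t - 2 * t * deriv h t ^ 2

def coeffB (h : ℝ → ℝ) (t : ℝ) : ℝ :=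
  (t ^ 2 + 3) * deriv h t + 2 * t * (t ^ 2 + 1) * deriv (deriv h) t

def coeffC (h : ℝ → ℝ) (t : ℝ) : ℝ :=
  4 * t * (deriv h t + t * deriv (deriv h) t)

end VolIso

end

namespace VolIso

open scoped Topology

/-! Along a rank-one line the squared Frobenius norm `N` is quadratic and the determinant `D` is
affine in `s`. The ratio `t` of the singular values satisfies `t + 1/t = N/D`, so `W` becomes `h
(largeRoot (N/D)) + f D`. Write `A = t² h''`, `B = t h'`, `φ = z² f''`. Where the singular values `x
> y` differ, the second derivative is the form `lineForm` in `α = a/x`, `δ = d/y`, `ε = (b² +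
c²)/(xy)` (`deriv_deriv_line`), where `a, d` are the diagonal and `b, c` the off-diagonal entries of
the direction in the singular frame. Rank one means `ad = bc`, so the only constraint is `ε ≥
2|αδ|`. Nonnegativity under it amounts to `Elliptic`: `B ≥ 0` handles the excess of `ε`, and
copositivity of one binary form for each sign of `αδ` gives the rest.

`Elliptic` is monotone (`Elliptic.mono`) and closed in `φ`, so it holds for every determinant
exactly when it holds at the infimum `f₀`. The symmetry `h t = h (1/t)` sends `(A, B)` to `(A + 2B,
-B)`. Hence `A + f₀ ≥ 0` and `A + 2B + f₀ ≥ 0` for `t > 1` together give `h₀ + f₀ ≥ 0`, and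
conditions 3 and 4 need checking only for `t > 1`. Equal singular values are reached by continuity.
-/

/-- The squared Frobenius norm of a `2 × 2` matrix. -/
def sqNorm (F : Matrix (Fin 2) (Fin 2) ℝ) : ℝ :=
  F 0 0 ^ 2 + F 0 1 ^ 2 + F 1 0 ^ 2 + F 1 1 ^ 2

/-! ### Singular values from the trace and determinant of `Fᵀ F` -/

theorem adjoint_comp_self_toEuclideanLin (F : Matrix (Fin 2) (Fin 2) ℝ) :
    (Matrix.toEuclideanLin F).adjoint ∘ₗ Matrix.toEuclideanLin F =
      Matrix.toLin (EuclideanSpace.basisFun (Fin 2) ℝ).toBasis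
        (EuclideanSpace.basisFun (Fin 2) ℝ).toBasis (F.transpose * F) := by
  rw [← Matrix.toEuclideanLin_conjTranspose_eq_adjoint, Matrix.conjTranspose_eq_transpose_of_trivial]
  simp only [Matrix.toEuclideanLin_eq_toLin_orthonormal]
  rw [← Matrix.toLin_mul]

theorem sv_sq_add (F : Matrix (Fin 2) (Fin 2) ℝ) : sv₁ F ^ 2 + sv₂ F ^ 2 = sqNorm F := by
  have hn : Module.finrank ℝ (EuclideanSpace ℝ (Fin 2)) = 2 := by simp
  have h0 := (Matrix.toEuclideanLin F).sq_singularValues_fin hn 0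
  have h1 := (Matrix.toEuclideanLin F).sq_singularValues_fin hn 1
  have h := (Matrix.toEuclideanLin F).isSymmetric_adjoint_comp_self.trace_eq_sum_eigenvalues hn
  have h' := (congrArg (LinearMap.trace ℝ _) (adjoint_comp_self_toEuclideanLin F)).symm.trans h
  rw [Matrix.trace_toLin_eq] at h'
  simp only [Fin.sum_univ_two, Matrix.trace, Matrix.diag, Matrix.mul_apply,
    Matrix.transpose_apply, RCLike.ofReal_real_eq_id, id] at h'
  simp only [Fin.val_zero, Fin.val_one] at h0 h1
  rw [sv₁, sv₂, sqNorm, h0, h1, ← h']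
  ring

theorem sv_mul_sq (F : Matrix (Fin 2) (Fin 2) ℝ) : (sv₁ F * sv₂ F) ^ 2 = F.det ^ 2 := by
  have hn : Module.finrank ℝ (EuclideanSpace ℝ (Fin 2)) = 2 := by simp
  have h0 := (Matrix.toEuclideanLin F).sq_singularValues_fin hn 0
  have h1 := (Matrix.toEuclideanLin F).sq_singularValues_fin hn 1
  have h := (Matrix.toEuclideanLin F).isSymmetric_adjoint_comp_self.det_eq_prod_eigenvalues hn
  have h' := (congrArg LinearMap.det (adjoint_comp_self_toEuclideanLin F)).symm.trans h
  rw [LinearMap.det_toLin, Matrix.det_mul, Matrix.det_transpose] at h'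
  simp only [Fin.prod_univ_two, RCLike.ofReal_real_eq_id, id] at h'
  simp only [Fin.val_zero, Fin.val_one] at h0 h1
  rw [sv₁, sv₂, mul_pow, h0, h1, ← h']
  ring

theorem sv₁_nonneg (F : Matrix (Fin 2) (Fin 2) ℝ) : 0 ≤ sv₁ F :=
  LinearMap.singularValues_nonneg _ _

theorem sv₂_nonneg (F : Matrix (Fin 2) (Fin 2) ℝ) : 0 ≤ sv₂ F :=
  LinearMap.singularValues_nonneg _ _

theorem sv₂_le_sv₁ (F : Matrix (Fin 2) (Fin 2) ℝ) : sv₂ F ≤ sv₁ F :=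
  LinearMap.singularValues_antitone _ zero_le_one

theorem sv_mul {F : Matrix (Fin 2) (Fin 2) ℝ} (hF : F ∈ GLp2) : sv₁ F * sv₂ F = F.det :=
  (sq_eq_sq₀ (mul_nonneg (sv₁_nonneg F) (sv₂_nonneg F)) (le_of_lt hF)).1 (sv_mul_sq F)

/-- The solution `r ≥ 1` of `r + 1 / r = m`, for `m ≥ 2`. -/
noncomputable def largeRoot (m : ℝ) : ℝ := (m + √(m ^ 2 - 4)) / 2

theorem largeRoot_add_inv {t : ℝ} (ht : 1 ≤ t) : largeRoot (t + 1 / t) = t := by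
  have h0 : 0 < t := by linarith
  have h1 : (t + 1 / t) ^ 2 - 4 = (t - 1 / t) ^ 2 := by field_simp; ring
  have h2 : 0 ≤ t - 1 / t := by
    rw [sub_nonneg, div_le_iff₀ h0]; nlinarith
  rw [largeRoot, h1, Real.sqrt_sq h2]; ring

theorem largeRoot_eq_div {x y : ℝ} (hy : 0 < y) (hyx : y ≤ x) :
    largeRoot ((x ^ 2 + y ^ 2) / (x * y)) = x / y := by
  have hx : 0 < x := hy.trans_le hyx
  rw [← largeRoot_add_inv ((one_le_div hy).2 hyx)]
  congr 1
  field_simp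

theorem hasDerivAt_largeRoot {t : ℝ} (ht : 1 < t) :
    HasDerivAt largeRoot (t ^ 2 / (t ^ 2 - 1)) (t + 1 / t) := by
  have h0 : 0 < t := by linarith
  have h1 : (t + 1 / t) ^ 2 - 4 = (t - 1 / t) ^ 2 := by field_simp; ring
  have h2 : 0 < t - 1 / t := by
    rw [sub_pos, div_lt_iff₀ h0]; nlinarith
  have h3 : (t + 1 / t) ^ 2 - 4 ≠ 0 := by rw [h1]; positivity
  have h4 := ((hasDerivAt_id (t + 1 / t)).add
    ((((hasDerivAt_id (t + 1 / t)).pow 2).sub_const 4).sqrt h3)).div_const 2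
  refine (h4.congr_deriv ?_)
  simp only [id, Pi.pow_apply]
  rw [h1, Real.sqrt_sq h2.le]
  have h5 : t ^ 2 - 1 ≠ 0 := by nlinarith
  have h6 : t - 1 / t = (t ^ 2 - 1) / t := by field_simp
  have h7 : t + 1 / t = (t ^ 2 + 1) / t := by field_simp
  rw [h6, h7]
  norm_num
  field_simp
  ring

theorem sv_div {F : Matrix (Fin 2) (Fin 2) ℝ} (hF : F ∈ GLp2) :
    sv₁ F / sv₂ F = largeRoot (sqNorm F / F.det) := by
  have h : 0 < sv₁ F * sv₂ F := by rw [sv_mul hF]; exact hF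
  have h2 : 0 < sv₂ F := pos_of_mul_pos_right h (sv₁_nonneg F)
  rw [← sv_mul hF, ← sv_sq_add, largeRoot_eq_div h2 (sv₂_le_sv₁ F)]

theorem exists_sv {N D : ℝ} (hD : 0 < D) (hN : 2 * D < N) :
    ∃ x y : ℝ, 0 < y ∧ y < x ∧ N = x ^ 2 + y ^ 2 ∧ D = x * y := by
  have h1 : √(N - 2 * D) < √(N + 2 * D) := Real.sqrt_lt_sqrt (by linarith) (by linarith)
  have h2 : 0 < √(N - 2 * D) := Real.sqrt_pos.2 (by linarith)
  have h3 : √(N - 2 * D) ^ 2 = N - 2 * D := Real.sq_sqrt (by linarith)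
  have h4 : √(N + 2 * D) ^ 2 = N + 2 * D := Real.sq_sqrt (by linarith)
  -- The choice solves `(x ± y)² = N ± 2D`.
  refine ⟨(√(N + 2 * D) + √(N - 2 * D)) / 2, (√(N + 2 * D) - √(N - 2 * D)) / 2,
    by linarith, by linarith, by linarith, by linarith⟩

/-! ### Copositive binary forms and the ellipticity conditions -/

theorem quadratic_nonneg_of {p q m α δ : ℝ} (hp : 0 ≤ p) (hq : 0 ≤ q)
    (h : 0 ≤ m ∨ m ^ 2 ≤ p * q) (hαδ : 0 ≤ α * δ) :
    0 ≤ p * α ^ 2 + 2 * m * (α * δ) + q * δ ^ 2 := by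
  rcases h with h | h
  · positivity
  · have h1 : -m ≤ √p * √q := by
      rw [← Real.sqrt_mul hp]
      exact (neg_le_abs m).trans (Real.abs_le_sqrt h)
    nlinarith [Real.sq_sqrt hp, Real.sq_sqrt hq, sq_nonneg (√p * α - √q * δ),
      mul_le_mul_of_nonneg_right h1 hαδ]

theorem of_quadratic_nonneg {p q m : ℝ} (hp : 0 ≤ p) (hq : 0 ≤ q)
    (h : ∀ α δ : ℝ, 0 ≤ α → 0 ≤ δ → 0 ≤ p * α ^ 2 + 2 * m * (α * δ) + q * δ ^ 2) :
    0 ≤ m ∨ m ^ 2 ≤ p * q := by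
  by_contra! hm
  obtain ⟨hm, hpq⟩ := hm
  rcases hp.eq_or_lt with rfl | hp
  -- For `p = 0` the form takes the value `-m² (q + 2)` here.
  · have h1 := h (q + 1) (-m) (by linarith) (by linarith)
    nlinarith [mul_pos (neg_pos.2 hm) (neg_pos.2 hm)]
  -- This is the direction minimizing over `α`; the value is `p (p q - m²)`.
  · have h1 := h (-m) p (by linarith) hp.le
    nlinarith

/-- The second derivative of a split energy along a rank-one line, in the frame of the singular
vectors. -/
noncomputable def lineForm (t A B φ α δ ε : ℝ) : ℝ :=
  (A + φ) * α ^ 2 + (A + 2 * B + φ) * δ ^ 2 +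
    (2 * φ - 2 * (A + B) + 2 * B * (t ^ 2 + 1) / (t ^ 2 - 1)) * (α * δ) +
    2 * B * t / (t ^ 2 - 1) * ε

/-- The ellipticity conditions at one ratio `t` of singular values and one determinant. -/
def Elliptic (t A B φ : ℝ) : Prop :=
  0 ≤ B ∧ 0 ≤ A + φ ∧ 0 ≤ A + 2 * B + φ ∧
    (0 ≤ 2 * B / (t - 1) - A + φ ∨
      (2 * B / (t - 1) - A + φ) ^ 2 ≤ (A + φ) * (A + 2 * B + φ)) ∧
    (0 ≤ 2 * B / (t + 1) + A - φ ∨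
      (2 * B / (t + 1) + A - φ) ^ 2 ≤ (A + φ) * (A + 2 * B + φ))

/-- Splits off the excess of `ε` over its least value when `αδ ≥ 0`; what remains is a binary form
on the quadrant. `lineForm_eq_sub` does the same for `αδ ≤ 0`. -/
theorem lineForm_eq_add {t : ℝ} (ht : 1 < t) (A B φ α δ ε : ℝ) :
    lineForm t A B φ α δ ε = (A + φ) * α ^ 2 + 2 * (2 * B / (t - 1) - A + φ) * (α * δ) +
      (A + 2 * B + φ) * δ ^ 2 + 2 * B * t / (t ^ 2 - 1) * (ε - 2 * (α * δ)) := by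
  have h1 : t - 1 ≠ 0 := by linarith
  have h2 : t ^ 2 - 1 ≠ 0 := by nlinarith
  have h3 : t ^ 2 - 1 = (t - 1) * (t + 1) := by ring
  have h4 : t + 1 ≠ 0 := by linarith
  rw [lineForm, h3]
  field_simp
  ring

theorem lineForm_eq_sub {t : ℝ} (ht : 1 < t) (A B φ α δ ε : ℝ) :
    lineForm t A B φ α δ ε = (A + φ) * α ^ 2 + 2 * (2 * B / (t + 1) + A - φ) * (α * (-δ)) +
      (A + 2 * B + φ) * (-δ) ^ 2 + 2 * B * t / (t ^ 2 - 1) * (ε + 2 * (α * δ)) := by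
  have h1 : t - 1 ≠ 0 := by linarith
  have h2 : t ^ 2 - 1 ≠ 0 := by nlinarith
  have h3 : t ^ 2 - 1 = (t - 1) * (t + 1) := by ring
  have h4 : t + 1 ≠ 0 := by linarith
  rw [lineForm, h3]
  field_simp
  ring

theorem Elliptic.lineForm_nonneg {t A B φ α δ ε : ℝ} (ht : 1 < t) (h : Elliptic t A B φ)
    (hε : 2 * |α * δ| ≤ ε) : 0 ≤ lineForm t A B φ α δ ε := by
  obtain ⟨hB, h1, h2, h3, h4⟩ := h
  have h5 : 0 ≤ 2 * B * t / (t ^ 2 - 1) :=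
    div_nonneg (by positivity) (by nlinarith)
  rcases le_total 0 (α * δ) with h0 | h0
  · rw [lineForm_eq_add ht]
    rw [abs_of_nonneg h0] at hε
    exact add_nonneg (quadratic_nonneg_of h1 h2 h3 h0) (mul_nonneg h5 (by linarith))
  · rw [lineForm_eq_sub ht]
    rw [abs_of_nonpos h0] at hε
    exact add_nonneg (quadratic_nonneg_of h1 h2 h4 (by linarith)) (mul_nonneg h5 (by linarith))

theorem elliptic_of_lineForm_nonneg {t A B φ : ℝ} (ht : 1 < t)
    (hB : 0 ≤ lineForm t A B φ 0 0 1)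
    (hadd : ∀ α δ : ℝ, 0 ≤ α → 0 ≤ δ → 0 ≤ lineForm t A B φ α δ (2 * (α * δ)))
    (hsub : ∀ α δ : ℝ, 0 ≤ α → 0 ≤ δ → 0 ≤ lineForm t A B φ α (-δ) (2 * (α * δ))) :
    Elliptic t A B φ := by
  have h1 : 0 ≤ A + φ := by simpa [lineForm] using hadd 1 0 zero_le_one le_rfl
  have h2 : 0 ≤ A + 2 * B + φ := by simpa [lineForm] using hadd 0 1 le_rfl zero_le_one
  refine ⟨?_, h1, h2, of_quadratic_nonneg h1 h2 fun α δ hα hδ => ?_,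
    of_quadratic_nonneg h1 h2 fun α δ hα hδ => ?_⟩
  · have h3 : 0 < 2 * t / (t ^ 2 - 1) := div_pos (by linarith) (by nlinarith)
    have h4 : lineForm t A B φ 0 0 1 = B * (2 * t / (t ^ 2 - 1)) := by
      simp only [lineForm]; ring
    rw [h4] at hB
    exact nonneg_of_mul_nonneg_left hB h3
  · have h3 := hadd α δ hα hδ
    rw [lineForm_eq_add ht] at h3
    linarith
  · have h3 := hsub α δ hα hδ
    rw [lineForm_eq_sub ht] at h3
    linarith

/-- In the first alternative, raising `φ` raises `2B/(t-1) - A + φ` and both factors of the product.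
The second is delicate because its linear term decreases. With `q = 2B/(t+1)`, however, product
minus square is affine in `φ`, equal to `2(2A + B + q)(A + φ) - (2A + q)²`, so only the sign of its
slope matters. -/
theorem Elliptic.mono {t A B φ₀ φ : ℝ} (ht : 1 < t) (h : Elliptic t A B φ₀) (hφ : φ₀ ≤ φ) :
    Elliptic t A B φ := by
  obtain ⟨hB, h1, h2, h3, h4⟩ := h
  refine ⟨hB, by linarith, by linarith, ?_, ?_⟩
  · have hp : 0 ≤ 2 * B / (t - 1) := div_nonneg (by linarith) (by linarith)
    generalize 2 * B / (t - 1) = p at *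
    by_contra! hc
    obtain ⟨hc1, hc2⟩ := hc
    rcases h3 with h3 | h3
    · linarith
    · set u := φ - φ₀ with hu
      set v := -(p - A + φ) with hv
      have hu0 : 0 ≤ u := by linarith
      have hv0 : 0 < v := by linarith
      have e1 : p - A + φ₀ = -(u + v) := by rw [hu, hv]; ring
      have e2 : φ = φ₀ + u := by rw [hu]; ring
      have e3 : p - A + φ = -v := by rw [hv]; ring
      rw [e1] at h3
      rw [e3, e2] at hc2
      nlinarith [mul_nonneg hu0 h1, mul_nonneg hu0 h2, mul_nonneg hu0 hv0.le]
  · have hq : 0 ≤ 2 * B / (t + 1) := div_nonneg (by linarith) (by linarith)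
    generalize 2 * B / (t + 1) = q at *
    by_contra! hc
    obtain ⟨hc1, hc2⟩ := hc
    have key : φ ^ 2 - (q + A - φ) ^ 2 + 2 * (A + B) * φ + A * (A + 2 * B) < 0 := by linarith
    -- If the linear term changes sign between `φ₀` and `φ`, compare with `φ = q + A`, where the
    -- square vanishes.
    rcases le_or_gt 0 (q + A - φ₀) with h5 | h5
    · have hα : 0 ≤ A + (q + A) := by linarith
      nlinarith [mul_nonneg hα (by linarith : 0 ≤ φ - (q + A)),
        mul_nonneg hB (by linarith : 0 ≤ φ - (q + A)), mul_nonneg hα hB, mul_nonneg hα hα]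
    · have h6 := h4.resolve_left (by linarith)
      -- A negative slope would force `2A + q < 0`, since `B ≥ 0`, and make the affine function
      -- negative already at `φ₀`.
      have hσ : 0 ≤ 2 * A + B + q := by
        by_contra! hσ
        have hα : 2 * A + q < 0 := by linarith
        nlinarith [mul_nonneg h1 (by linarith : 0 ≤ -(2 * A + B + q)), mul_pos_of_neg_of_neg hα hα]
      nlinarith [mul_nonneg hσ (by linarith : 0 ≤ φ - φ₀)]

/-! ### Second derivatives along lines -/

theorem convexOn_iff_deriv2_nonneg {S : Set ℝ} {φ : ℝ → ℝ} (hS : IsOpen S) (hS' : Convex ℝ S)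
    (hφ : ContDiffOn ℝ 2 φ S) : ConvexOn ℝ S φ ↔ ∀ s ∈ S, 0 ≤ deriv (deriv φ) s := by
  have h1 : DifferentiableOn ℝ φ S := hφ.differentiableOn (by norm_num)
  have h2 : DifferentiableOn ℝ (deriv φ) S :=
    (hφ.deriv_of_isOpen (m := 1) hS (by norm_num)).differentiableOn (by norm_num)
  refine ⟨fun h s hs => ?_, convexOn_of_deriv2_nonneg' hS' h1 h2⟩
  have h3 := h.monotoneOn_deriv fun x hx => h1.differentiableAt (hS.mem_nhds hx)
  rw [← derivWithin_of_isOpen hS hs]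
  exact h3.derivWithin_nonneg

theorem hasDerivAt_deriv_of_contDiffOn {u : ℝ → ℝ} (hu : ContDiffOn ℝ 2 u (Ioi 0)) {t : ℝ}
    (ht : 0 < t) :
    HasDerivAt u (deriv u t) t ∧ HasDerivAt (deriv u) (deriv (deriv u) t) t := by
  have h2 : DifferentiableOn ℝ (deriv u) (Ioi 0) :=
    (hu.deriv_of_isOpen (m := 1) isOpen_Ioi (by norm_num)).differentiableOn (by norm_num)
  exact ⟨((hu.differentiableOn (by norm_num)).differentiableAt (Ioi_mem_nhds ht)).hasDerivAt,
    (h2.differentiableAt (Ioi_mem_nhds ht)).hasDerivAt⟩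

theorem largeRoot_spec {m : ℝ} (hm : 2 < m) :
    1 < largeRoot m ∧ HasDerivAt largeRoot (largeRoot m ^ 2 / (largeRoot m ^ 2 - 1)) m := by
  obtain ⟨x, y, hy, hyx, h1, h2⟩ := exists_sv (N := m) (D := 1) one_pos (by linarith)
  have ht : 1 < x / y := (one_lt_div hy).2 hyx
  have hx : 0 < x := hy.trans hyx
  have h3 : m = x / y + 1 / (x / y) := by
    field_simp
    linear_combination x * y * h1 - (x ^ 2 + y ^ 2) * h2
  rw [h3, largeRoot_add_inv ht.le]
  exact ⟨ht, hasDerivAt_largeRoot ht⟩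

theorem deriv_deriv_split {h f N N' D : ℝ → ℝ} {D₁ N₂ s₀ x y a d : ℝ}
    (hh : ContDiffOn ℝ 2 h (Ioi 0)) (hf : ContDiffOn ℝ 2 f (Ioi 0))
    (hN : ∀ s, HasDerivAt N (N' s) s) (hN' : HasDerivAt N' (2 * N₂) s₀)
    (hD : ∀ s, HasDerivAt D D₁ s) (hy : 0 < y) (hyx : y < x)
    (hNx : N s₀ = x ^ 2 + y ^ 2) (hDx : D s₀ = x * y)
    (hNa : N' s₀ = 2 * (x * a + y * d)) (hDa : D₁ = x * d + y * a) :
    deriv (deriv fun s => h (largeRoot (N s / D s)) + f (D s)) s₀ =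
      lineForm (x / y) ((x / y) ^ 2 * deriv (deriv h) (x / y)) (x / y * deriv h (x / y))
        ((x * y) ^ 2 * deriv (deriv f) (x * y)) (a / x) (d / y)
        ((N₂ - a ^ 2 - d ^ 2) / (x * y)) := by
  have hx : 0 < x := hy.trans hyx
  have hNc : Continuous N := continuous_iff_continuousAt.2 fun s => (hN s).continuousAt
  have hDc : Continuous D := continuous_iff_continuousAt.2 fun s => (hD s).continuousAt
  have hD0 : 0 < D s₀ := by rw [hDx]; positivity
  have hND : 2 * D s₀ < N s₀ := by
    rw [hDx, hNx]; nlinarith [mul_pos (sub_pos.2 hyx) (sub_pos.2 hyx)]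
  have hroot : largeRoot (N s₀ / D s₀) = x / y := by rw [hNx, hDx, largeRoot_eq_div hy hyx.le]
  have hder : ∀ s, 0 < D s → 2 * D s < N s → 1 < largeRoot (N s / D s) ∧
      HasDerivAt (fun s => largeRoot (N s / D s))
        (largeRoot (N s / D s) ^ 2 / (largeRoot (N s / D s) ^ 2 - 1) *
          ((N' s * D s - N s * D₁) / D s ^ 2)) s := by
    intro s h1 h2
    obtain ⟨h3, h4⟩ := largeRoot_spec ((lt_div_iff₀ h1).2 h2)
    have h5 : HasDerivAt (fun s => N s / D s) ((N' s * D s - N s * D₁) / D s ^ 2) s :=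
      (hN s).div (hD s) h1.ne'
    have h6 := HasDerivAt.comp s h4 h5
    exact ⟨h3, h6⟩
  -- The first derivative is needed on a neighbourhood, where `N > 2D` persists; `largeRoot` is
  -- singular at `2`.
  have hev : (deriv fun s => h (largeRoot (N s / D s)) + f (D s)) =ᶠ[𝓝 s₀] fun s =>
      deriv h (largeRoot (N s / D s)) *
        (largeRoot (N s / D s) ^ 2 / (largeRoot (N s / D s) ^ 2 - 1) *
          ((N' s * D s - N s * D₁) / D s ^ 2)) + deriv f (D s) * D₁ := by
    filter_upwards [hDc.continuousAt.eventually (lt_mem_nhds hD0),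
      (isOpen_lt (hDc.const_mul 2) hNc).mem_nhds hND] with s h1 h2
    obtain ⟨h3, h4⟩ := hder s h1 h2
    exact ((HasDerivAt.comp s (hasDerivAt_deriv_of_contDiffOn hh (by linarith)).1 h4).add
      (HasDerivAt.comp s (hasDerivAt_deriv_of_contDiffOn hf h1).1 (hD s))).deriv
  rw [hev.deriv_eq]
  obtain ⟨h3, h4⟩ := hder s₀ hD0 hND
  have ht1 : largeRoot (N s₀ / D s₀) ^ 2 - 1 ≠ 0 := by nlinarith
  have hT := h4.pow 2
  have h5 := (HasDerivAt.comp s₀ (hasDerivAt_deriv_of_contDiffOn hh (by linarith)).2 h4).mul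
    ((hT.div (hT.sub_const 1) ht1).mul
      (((hN'.mul (hD s₀)).sub ((hN s₀).mul_const D₁)).div ((hD s₀).pow 2)
        (pow_ne_zero 2 hD0.ne')))
  have h6 := h5.add ((HasDerivAt.comp s₀ (hasDerivAt_deriv_of_contDiffOn hf hD0).2
    (hD s₀)).mul_const D₁)
  refine (h6.deriv).trans ?_
  have hxy : x ^ 2 - y ^ 2 ≠ 0 := by nlinarith
  have e1 : (x / y) ^ 2 - 1 = (x ^ 2 - y ^ 2) / y ^ 2 := by field_simp
  simp only [Function.comp_apply, Pi.pow_apply, Pi.mul_apply, Pi.div_apply, Pi.sub_apply, lineForm,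
    hroot]
  simp only [hNx, hDx, hNa, hDa, e1]
  generalize deriv (deriv h) (x / y) = h₂
  generalize deriv (deriv f) (x * y) = f₂
  generalize deriv h (x / y) = h₁
  norm_num
  field_simp
  ring

/-- The Frobenius inner product of `2 × 2` matrices. -/
def dotMat (F H : Matrix (Fin 2) (Fin 2) ℝ) : ℝ :=
  F 0 0 * H 0 0 + F 0 1 * H 0 1 + F 1 0 * H 1 0 + F 1 1 * H 1 1

/-- The polarization of the determinant of `2 × 2` matrices. -/
def polarDet (F H : Matrix (Fin 2) (Fin 2) ℝ) : ℝ :=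
  F 0 0 * H 1 1 + F 1 1 * H 0 0 - F 0 1 * H 1 0 - F 1 0 * H 0 1

theorem det_add_smul {F H : Matrix (Fin 2) (Fin 2) ℝ} (hH : H.det = 0) (s : ℝ) :
    (F + s • H).det = F.det + s * polarDet F H := by
  simp only [Matrix.det_fin_two, polarDet, Matrix.add_apply, Matrix.smul_apply, smul_eq_mul] at *
  linear_combination s ^ 2 * hH

theorem sqNorm_add_smul (F H : Matrix (Fin 2) (Fin 2) ℝ) (s : ℝ) :
    sqNorm (F + s • H) = sqNorm F + 2 * s * dotMat F H + s ^ 2 * sqNorm H := by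
  simp only [sqNorm, dotMat, Matrix.add_apply, Matrix.smul_apply, smul_eq_mul]
  ring

theorem polarDet_add_smul {F H : Matrix (Fin 2) (Fin 2) ℝ} (hH : H.det = 0) (s : ℝ) :
    polarDet (F + s • H) H = polarDet F H := by
  simp only [Matrix.det_fin_two, polarDet, Matrix.add_apply, Matrix.smul_apply, smul_eq_mul] at *
  linear_combination 2 * s * hH

theorem dotMat_add_smul (F H : Matrix (Fin 2) (Fin 2) ℝ) (s : ℝ) :
    dotMat (F + s • H) H = dotMat F H + s * sqNorm H := by
  simp only [sqNorm, dotMat, Matrix.add_apply, Matrix.smul_apply, smul_eq_mul]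
  ring

theorem isOpen_line {F H : Matrix (Fin 2) (Fin 2) ℝ} (hH : H.det = 0) :
    IsOpen {s : ℝ | F + s • H ∈ GLp2} := by
  simp only [GLp2, mem_ofPred_eq, det_add_smul hH]
  exact isOpen_lt continuous_const (by fun_prop)

theorem convex_line {F H : Matrix (Fin 2) (Fin 2) ℝ} (hH : H.det = 0) :
    Convex ℝ {s : ℝ | F + s • H ∈ GLp2} := by
  simp only [GLp2, mem_ofPred_eq, det_add_smul hH]
  intro r hr s hs p q hp hq hpq
  simp only [mem_ofPred_eq, smul_eq_mul] at *
  have h1 : F.det + (p * r + q * s) * polarDet F H =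
      p * (F.det + r * polarDet F H) + q * (F.det + s * polarDet F H) := by
    linear_combination (-F.det) * hpq
  rw [h1]
  rcases hp.eq_or_lt with rfl | hp
  · have : q = 1 := by linarith
    subst this; linarith
  · have h2 := mul_pos hp hr
    have h3 := mul_nonneg hq hs.le
    linarith

theorem contDiffOn_line {W : Matrix (Fin 2) (Fin 2) ℝ → ℝ} (hW : ContDiffOn ℝ 2 W GLp2)
    (F H : Matrix (Fin 2) (Fin 2) ℝ) :
    ContDiffOn ℝ 2 (fun s : ℝ => W (F + s • H)) {s : ℝ | F + s • H ∈ GLp2} := by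
  have h : ContDiff ℝ 2 fun s : ℝ => F + s • H :=
    contDiff_const.add (contDiff_id.smul contDiff_const)
  exact hW.comp h.contDiffOn fun s hs => hs

theorem deriv_deriv_line {W : Matrix (Fin 2) (Fin 2) ℝ → ℝ} {h f : ℝ → ℝ}
    (hh : ContDiffOn ℝ 2 h (Ioi 0)) (hf : ContDiffOn ℝ 2 f (Ioi 0))
    (hsplit : ∀ F ∈ GLp2, W F = h (sv₁ F / sv₂ F) + f (sv₁ F * sv₂ F))
    {F H : Matrix (Fin 2) (Fin 2) ℝ} (hH : H.det = 0) {s x y a d : ℝ} (hy : 0 < y) (hyx : y < x)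
    (hN : sqNorm (F + s • H) = x ^ 2 + y ^ 2) (hD : (F + s • H).det = x * y)
    (ha : dotMat (F + s • H) H = x * a + y * d) (hd : polarDet (F + s • H) H = x * d + y * a) :
    deriv (deriv fun r : ℝ => W (F + r • H)) s =
      lineForm (x / y) ((x / y) ^ 2 * deriv (deriv h) (x / y)) (x / y * deriv h (x / y))
        ((x * y) ^ 2 * deriv (deriv f) (x * y)) (a / x) (d / y)
        ((sqNorm H - a ^ 2 - d ^ 2) / (x * y)) := by
  have hs : s ∈ {s : ℝ | F + s • H ∈ GLp2} := by
    simp only [GLp2, mem_ofPred_eq, hD]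
    exact mul_pos (hy.trans hyx) hy
  have hev : (fun r : ℝ => W (F + r • H)) =ᶠ[𝓝 s] fun r =>
      h (largeRoot (sqNorm (F + r • H) / (F + r • H).det)) + f (F + r • H).det := by
    filter_upwards [(isOpen_line hH).mem_nhds hs] with r hr
    rw [hsplit _ hr, sv_div hr, sv_mul hr]
  rw [hev.deriv.deriv_eq]
  refine deriv_deriv_split (N' := fun r => 2 * dotMat (F + r • H) H) (D₁ := polarDet F H) hh hf
    (fun r => ?_) ?_ (fun r => ?_) hy hyx hN hD (by rw [ha]) (by rw [← hd, polarDet_add_smul hH])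
  · simp only [sqNorm_add_smul, dotMat_add_smul]
    have h1 := (((hasDerivAt_id r).const_mul (2 * dotMat F H)).const_add (sqNorm F)).add
      (((hasDerivAt_id r).pow 2).mul_const (sqNorm H))
    refine (h1.congr_of_eventuallyEq (Filter.Eventually.of_forall fun u => ?_)).congr_deriv ?_
    · simp; ring
    · simp; ring
  · simp only [dotMat_add_smul]
    have h1 := (((hasDerivAt_id s).mul_const (sqNorm H)).const_add (dotMat F H)).const_mul 2
    exact h1.congr_deriv (by simp)
  · simp only [det_add_smul hH]
    have h1 := ((hasDerivAt_id r).mul_const (polarDet F H)).const_add F.det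
    exact h1.congr_deriv (by simp)

/-! ### Rank-one directions, conformal and anticonformal parts -/

theorem det_vecMulVec (ξ η : Fin 2 → ℝ) : (Matrix.vecMulVec ξ η).det = 0 := by
  simp only [Matrix.det_fin_two, Matrix.vecMulVec_apply]
  ring

/-- Cauchy–Schwarz for the conformal parts of `F` and `H`. As `det H = 0`, the conformal and
anticonformal parts of `H` carry the same norm; the next lemma uses the anticonformal ones. -/
theorem sq_dotMat_add_polarDet_le {F H : Matrix (Fin 2) (Fin 2) ℝ} (hH : H.det = 0) :
    (dotMat F H + polarDet F H) ^ 2 ≤ (sqNorm F + 2 * F.det) * sqNorm H := by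
  have h1 : sqNorm H = (H 0 0 + H 1 1) ^ 2 + (H 0 1 - H 1 0) ^ 2 := by
    simp only [sqNorm, Matrix.det_fin_two] at *
    linear_combination -2 * hH
  rw [h1]
  simp only [dotMat, polarDet, sqNorm, Matrix.det_fin_two]
  nlinarith [sq_nonneg ((F 0 0 + F 1 1) * (H 0 1 - H 1 0) - (F 0 1 - F 1 0) * (H 0 0 + H 1 1))]

theorem sq_dotMat_sub_polarDet_le {F H : Matrix (Fin 2) (Fin 2) ℝ} (hH : H.det = 0) :
    (dotMat F H - polarDet F H) ^ 2 ≤ (sqNorm F - 2 * F.det) * sqNorm H := by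
  have h1 : sqNorm H = (H 0 0 - H 1 1) ^ 2 + (H 0 1 + H 1 0) ^ 2 := by
    simp only [sqNorm, Matrix.det_fin_two] at *
    linear_combination 2 * hH
  rw [h1]
  simp only [dotMat, polarDet, sqNorm, Matrix.det_fin_two]
  nlinarith [sq_nonneg ((F 0 0 - F 1 1) * (H 0 1 + H 1 0) - (F 0 1 + F 1 0) * (H 0 0 - H 1 1))]

theorem sqNorm_sub_det_nonneg (F : Matrix (Fin 2) (Fin 2) ℝ) : 0 ≤ sqNorm F - 2 * F.det := by
  simp only [sqNorm, Matrix.det_fin_two]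
  nlinarith [sq_nonneg (F 0 0 - F 1 1), sq_nonneg (F 0 1 + F 1 0)]

/-- Equality at `s` kills the anticonformal part of `F + s • H`, so that of `F + r • H` is `r - s`
times that of `H`. Thus a nonconstant rank-one line has at most one point with equal singular
values. -/
theorem sqNorm_sub_det_line {F H : Matrix (Fin 2) (Fin 2) ℝ} (hH : H.det = 0) {s : ℝ}
    (hs : sqNorm (F + s • H) = 2 * (F + s • H).det) (r : ℝ) :
    sqNorm (F + r • H) - 2 * (F + r • H).det = (r - s) ^ 2 * sqNorm H := by
  have h1 : F 0 0 + s * H 0 0 - (F 1 1 + s * H 1 1) = 0 ∧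
      F 0 1 + s * H 0 1 + (F 1 0 + s * H 1 0) = 0 := by
    simp only [sqNorm, Matrix.det_fin_two, Matrix.add_apply, Matrix.smul_apply, smul_eq_mul] at hs
    constructor
    · nlinarith [sq_nonneg (F 0 0 + s * H 0 0 - (F 1 1 + s * H 1 1)),
        sq_nonneg (F 0 1 + s * H 0 1 + (F 1 0 + s * H 1 0))]
    · nlinarith [sq_nonneg (F 0 0 + s * H 0 0 - (F 1 1 + s * H 1 1)),
        sq_nonneg (F 0 1 + s * H 0 1 + (F 1 0 + s * H 1 0))]
  obtain ⟨h1, h2⟩ := h1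
  have h3 : F 0 0 = F 1 1 + s * H 1 1 - s * H 0 0 := by linarith
  have h4 : F 0 1 = -(F 1 0 + s * H 1 0) - s * H 0 1 := by linarith
  simp only [sqNorm, Matrix.det_fin_two, Matrix.add_apply, Matrix.smul_apply, smul_eq_mul] at *
  rw [h3, h4]
  linear_combination (-2) * (r - s) ^ 2 * hH

theorem sqNorm_pos {H : Matrix (Fin 2) (Fin 2) ℝ} (hH : H ≠ 0) : 0 < sqNorm H := by
  have h0 : 0 ≤ sqNorm H := by simp only [sqNorm]; positivity
  refine h0.lt_of_ne fun h => hH ?_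
  simp only [sqNorm] at h
  ext i j
  fin_cases i <;> fin_cases j <;> simp <;> nlinarith [sq_nonneg (H 0 0), sq_nonneg (H 0 1),
    sq_nonneg (H 1 0), sq_nonneg (H 1 1)]

theorem rankOneConvex_iff_deriv {W : Matrix (Fin 2) (Fin 2) ℝ → ℝ} (hW : ContDiffOn ℝ 2 W GLp2) :
    RankOneConvex W ↔ ∀ F ∈ GLp2, ∀ ξ η : Fin 2 → ℝ,
      ∀ s ∈ {s : ℝ | F + s • Matrix.vecMulVec ξ η ∈ GLp2},
        0 ≤ deriv (deriv fun r : ℝ => W (F + r • Matrix.vecMulVec ξ η)) s :=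
  forall₄_congr fun F _ ξ η => convexOn_iff_deriv2_nonneg (isOpen_line (det_vecMulVec ξ η))
    (convex_line (det_vecMulVec ξ η)) (contDiffOn_line hW F _)

theorem deriv_deriv_line_nonneg_of_lt {W : Matrix (Fin 2) (Fin 2) ℝ → ℝ} {h f : ℝ → ℝ}
    (hh : ContDiffOn ℝ 2 h (Ioi 0)) (hf : ContDiffOn ℝ 2 f (Ioi 0))
    (hsplit : ∀ F ∈ GLp2, W F = h (sv₁ F / sv₂ F) + f (sv₁ F * sv₂ F))
    (hE : ∀ t z : ℝ, 1 < t → 0 < z →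
      Elliptic t (t ^ 2 * deriv (deriv h) t) (t * deriv h t) (z ^ 2 * deriv (deriv f) z))
    {F H : Matrix (Fin 2) (Fin 2) ℝ} (hH : H.det = 0) {s : ℝ} (hs : F + s • H ∈ GLp2)
    (hlt : 2 * (F + s • H).det < sqNorm (F + s • H)) :
    0 ≤ deriv (deriv fun r : ℝ => W (F + r • H)) s := by
  obtain ⟨x, y, hy, hyx, hN, hD⟩ := exists_sv hs hlt
  have hx : 0 < x := hy.trans hyx
  have hxy : x ^ 2 - y ^ 2 ≠ 0 := by nlinarith
  set p := dotMat (F + s • H) H with hp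
  set q := polarDet (F + s • H) H with hq
  -- Cramer's rule recovers the diagonal entries of `H` in the singular frame, so no singular
  -- vectors are needed.
  obtain ⟨a, ha⟩ : ∃ a, a = (x * p - y * q) / (x ^ 2 - y ^ 2) := ⟨_, rfl⟩
  obtain ⟨d, hd⟩ : ∃ d, d = (x * q - y * p) / (x ^ 2 - y ^ 2) := ⟨_, rfl⟩
  have hpa : p = x * a + y * d := by rw [ha, hd]; field_simp; ring
  have hqd : q = x * d + y * a := by rw [ha, hd]; field_simp; ring
  rw [deriv_deriv_line hh hf hsplit hH hy hyx hN hD hpa hqd]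
  have ht : 1 < x / y := (one_lt_div hy).2 hyx
  refine (hE _ _ ht (mul_pos hx hy)).lineForm_nonneg ht ?_
  have h1 := sq_dotMat_add_polarDet_le (F := F + s • H) hH
  have h2 := sq_dotMat_sub_polarDet_le (F := F + s • H) hH
  rw [← hp, ← hq, hpa, hqd, hN, hD] at h1 h2
  -- The bounds on `(a ± d)²` together say `2|ad| ≤ |H|² - a² - d²`, the constraint on `ε`.
  have h3 : (a + d) ^ 2 ≤ sqNorm H := by
    have h4 : 0 < (x + y) ^ 2 := by positivity
    refine le_of_mul_le_mul_left ?_ h4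
    linarith
  have h4 : (a - d) ^ 2 ≤ sqNorm H := by
    have h5 : 0 < (x - y) ^ 2 := pow_pos (sub_pos.2 hyx) 2
    refine le_of_mul_le_mul_left ?_ h5
    linarith
  have h5 : a / x * (d / y) = a * d / (x * y) := by field_simp
  rw [h5, abs_div, abs_of_pos (mul_pos hx hy), ← mul_div_assoc,
    div_le_div_iff_of_pos_right (mul_pos hx hy)]
  rcases abs_cases (a * d) with ⟨h6, -⟩ | ⟨h6, -⟩ <;> rw [h6] <;> linarith

theorem rankOneConvex_of_elliptic {W : Matrix (Fin 2) (Fin 2) ℝ → ℝ} {h f : ℝ → ℝ}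
    (hW : ContDiffOn ℝ 2 W GLp2) (hh : ContDiffOn ℝ 2 h (Ioi 0)) (hf : ContDiffOn ℝ 2 f (Ioi 0))
    (hsplit : ∀ F ∈ GLp2, W F = h (sv₁ F / sv₂ F) + f (sv₁ F * sv₂ F))
    (hE : ∀ t z : ℝ, 1 < t → 0 < z →
      Elliptic t (t ^ 2 * deriv (deriv h) t) (t * deriv h t) (z ^ 2 * deriv (deriv f) z)) :
    RankOneConvex W := by
  rw [rankOneConvex_iff_deriv hW]
  intro F hF ξ η s hs
  have hH := det_vecMulVec ξ η
  generalize Matrix.vecMulVec ξ η = H at *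
  rcases (sqNorm_sub_det_nonneg (F + s • H)).lt_or_eq with hlt | heq
  · exact deriv_deriv_line_nonneg_of_lt hh hf hsplit hE hH hs (by linarith)
  rcases eq_or_ne H 0 with rfl | hH0
  · simp
  -- At a point with equal singular values, nonnegativity is a limit from the nearby points of the
  -- line.
  have hcont : ContinuousAt (deriv (deriv fun r : ℝ => W (F + r • H))) s := by
    have hO := isOpen_line (F := F) hH
    have h1 := (contDiffOn_line hW F H).deriv_of_isOpen (m := 1) hO (by norm_num)
    exact (h1.continuousOn_deriv_of_isOpen hO (by norm_num)).continuousAt (hO.mem_nhds hs)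
  refine ge_of_tendsto (hcont.tendsto.mono_left (nhdsWithin_le_nhds (s := {s}ᶜ))) ?_
  filter_upwards [nhdsWithin_le_nhds ((isOpen_line (F := F) hH).mem_nhds hs),
    self_mem_nhdsWithin] with r hr hrs
  refine deriv_deriv_line_nonneg_of_lt hh hf hsplit hE hH hr ?_
  have h1 := sqNorm_sub_det_line hH (show sqNorm (F + s • H) = 2 * (F + s • H).det by linarith) r
  have h2 : 0 < (r - s) ^ 2 := by
    have : r - s ≠ 0 := sub_ne_zero.2 hrs
    positivity
  have h3 := mul_pos h2 (sqNorm_pos hH0)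
  linarith

/-! ### Necessity: testing at diagonal matrices -/

theorem RankOneConvex.lineForm_nonneg {W : Matrix (Fin 2) (Fin 2) ℝ → ℝ} {h f : ℝ → ℝ}
    (hR : RankOneConvex W)
    (hW : ContDiffOn ℝ 2 W GLp2) (hh : ContDiffOn ℝ 2 h (Ioi 0)) (hf : ContDiffOn ℝ 2 f (Ioi 0))
    (hsplit : ∀ F ∈ GLp2, W F = h (sv₁ F / sv₂ F) + f (sv₁ F * sv₂ F))
    {x y : ℝ} (hy : 0 < y) (hyx : y < x) (ξ η : Fin 2 → ℝ) :
    0 ≤ lineForm (x / y) ((x / y) ^ 2 * deriv (deriv h) (x / y)) (x / y * deriv h (x / y))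
        ((x * y) ^ 2 * deriv (deriv f) (x * y)) (ξ 0 * η 0 / x) (ξ 1 * η 1 / y)
        (((ξ 0 * η 1) ^ 2 + (ξ 1 * η 0) ^ 2) / (x * y)) := by
  have hx : 0 < x := hy.trans hyx
  have hdet : (!![x, 0; 0, y] : Matrix (Fin 2) (Fin 2) ℝ).det = x * y := by
    simp [Matrix.det_fin_two]
  have hF : (!![x, 0; 0, y] : Matrix (Fin 2) (Fin 2) ℝ) ∈ GLp2 := by
    simp only [GLp2, mem_ofPred_eq, hdet]
    positivity
  have h1 := (rankOneConvex_iff_deriv hW).1 hR _ hF ξ η 0 (by simpa using hF)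
  rw [deriv_deriv_line hh hf hsplit (det_vecMulVec ξ η) hy hyx (a := ξ 0 * η 0) (d := ξ 1 * η 1)
    (by simp [sqNorm]) (by simp) (by simp [dotMat, Matrix.vecMulVec_apply])
    (by simp [polarDet, Matrix.vecMulVec_apply])] at h1
  convert h1 using 2
  simp only [sqNorm, Matrix.vecMulVec_apply]
  ring

theorem RankOneConvex.elliptic {W : Matrix (Fin 2) (Fin 2) ℝ → ℝ} {h f : ℝ → ℝ}
    (hR : RankOneConvex W)
    (hW : ContDiffOn ℝ 2 W GLp2) (hh : ContDiffOn ℝ 2 h (Ioi 0)) (hf : ContDiffOn ℝ 2 f (Ioi 0))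
    (hsplit : ∀ F ∈ GLp2, W F = h (sv₁ F / sv₂ F) + f (sv₁ F * sv₂ F))
    {t z : ℝ} (ht : 1 < t) (hz : 0 < z) :
    Elliptic t (t ^ 2 * deriv (deriv h) t) (t * deriv h t) (z ^ 2 * deriv (deriv f) z) := by
  have ht0 : 0 < t := by linarith
  -- The test matrix `diag (t y, y)` has ratio `t` and determinant `z`.
  obtain ⟨y, hy, hyz⟩ : ∃ y : ℝ, 0 < y ∧ y ^ 2 = z / t :=
    ⟨√(z / t), Real.sqrt_pos.2 (by positivity), Real.sq_sqrt (by positivity)⟩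
  have hyx : y < t * y := by nlinarith
  have key := hR.lineForm_nonneg hW hh hf hsplit hy hyx
  have e1 : t * y / y = t := by field_simp
  have e2 : t * y * y = z := by rw [mul_assoc, ← sq, hyz]; field_simp
  have hx : 0 < t * y := by positivity
  rw [e1, e2] at key
  refine elliptic_of_lineForm_nonneg ht ?_ (fun α δ hα hδ => ?_) fun α δ hα hδ => ?_
  -- A purely off-diagonal direction isolates `ε`. The two others have off-diagonal entries equal up
  -- to sign, hence the extreme value of `ε`.
  · have h1 := key ![√z, 0] ![0, 1]
    have e3 : √z ^ 2 / z = 1 := by rw [Real.sq_sqrt hz.le, div_self hz.ne']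
    simpa [e3] using h1
  · have h1 := key ![√(t * y * α), √(y * δ)] ![√(t * y * α), √(y * δ)]
    have hα' := Real.mul_self_sqrt (show 0 ≤ t * y * α by positivity)
    have hδ' := Real.mul_self_sqrt (show 0 ≤ y * δ by positivity)
    have e3 : ((√(t * y * α) * √(y * δ)) ^ 2 + (√(y * δ) * √(t * y * α)) ^ 2) / z =
        2 * (α * δ) := by
      rw [div_eq_iff hz.ne', ← e2]
      linear_combination 2 * (√(y * δ) * √(y * δ)) * hα' + 2 * (t * y * α) * hδ'
    simp only [Matrix.cons_val_zero, Matrix.cons_val_one, e3, hα', hδ',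
      mul_div_cancel_left₀ _ hx.ne', mul_div_cancel_left₀ _ hy.ne'] at h1
    exact h1
  · have h1 := key ![√(t * y * α), √(y * δ)] ![√(t * y * α), -√(y * δ)]
    have hα' := Real.mul_self_sqrt (show 0 ≤ t * y * α by positivity)
    have hδ' := Real.mul_self_sqrt (show 0 ≤ y * δ by positivity)
    have e3 : ((-(√(t * y * α) * √(y * δ))) ^ 2 + (√(y * δ) * √(t * y * α)) ^ 2) / z =
        2 * (α * δ) := by
      rw [div_eq_iff hz.ne', ← e2]
      linear_combination 2 * (√(y * δ) * √(y * δ)) * hα' + 2 * (t * y * α) * hδ'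
    simp only [Matrix.cons_val_zero, Matrix.cons_val_one, e3, hα', hδ', mul_neg, neg_div,
      mul_div_cancel_left₀ _ hx.ne', mul_div_cancel_left₀ _ hy.ne'] at h1
    exact h1

/-! ### Passage to the infimum and inversion symmetry -/

theorem isClosed_setOf_elliptic (t A B : ℝ) : IsClosed {φ : ℝ | Elliptic t A B φ} := by
  simp only [Elliptic, ofPred_and, ofPred_or]
  refine isClosed_const.inter (IsClosed.inter ?_ (IsClosed.inter ?_ (IsClosed.inter ?_ ?_)))
  · exact isClosed_le continuous_const (by fun_prop)
  · exact isClosed_le continuous_const (by fun_prop)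
  · exact (isClosed_le continuous_const (by fun_prop)).union
      (isClosed_le (by fun_prop) (by fun_prop))
  · exact (isClosed_le continuous_const (by fun_prop)).union
      (isClosed_le (by fun_prop) (by fun_prop))

theorem deriv_inv_of_symm {h : ℝ → ℝ} (hh : ContDiffOn ℝ 2 h (Ioi 0))
    (hsymm : ∀ t : ℝ, 0 < t → h t = h (1 / t)) {t : ℝ} (ht : 0 < t) :
    t⁻¹ * deriv h t⁻¹ = -(t * deriv h t) := by
  have h1 := HasDerivAt.comp t (hasDerivAt_deriv_of_contDiffOn hh (inv_pos.2 ht)).1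
    (hasDerivAt_inv ht.ne')
  have h2 : h =ᶠ[𝓝 t] h ∘ fun t => t⁻¹ := by
    filter_upwards [Ioi_mem_nhds ht] with s hs
    rw [hsymm s hs, one_div, Function.comp_apply]
  rw [h2.deriv_eq, h1.deriv]
  field_simp

theorem deriv_deriv_inv_of_symm {h : ℝ → ℝ} (hh : ContDiffOn ℝ 2 h (Ioi 0))
    (hsymm : ∀ t : ℝ, 0 < t → h t = h (1 / t)) {t : ℝ} (ht : 0 < t) :
    t⁻¹ ^ 2 * deriv (deriv h) t⁻¹ = t ^ 2 * deriv (deriv h) t + 2 * (t * deriv h t) := by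
  have h1 := (hasDerivAt_inv ht.ne').mul (HasDerivAt.comp t
    (hasDerivAt_deriv_of_contDiffOn hh (inv_pos.2 ht)).2 (hasDerivAt_inv ht.ne'))
  have h2 := ((hasDerivAt_id t).mul (hasDerivAt_deriv_of_contDiffOn hh ht).2).neg
  have h3 : (Inv.inv * (deriv h ∘ Inv.inv)) =ᶠ[𝓝 t] -(id * deriv h) := by
    filter_upwards [Ioi_mem_nhds ht] with s hs
    simpa using deriv_inv_of_symm hh hsymm hs
  have h4 := (h1.congr_of_eventuallyEq h3.symm).unique h2
  have h5 := deriv_inv_of_symm hh hsymm ht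
  simp only [Function.comp_apply, id] at h4
  field_simp at h4 h5 ⊢
  linear_combination (-1) * h4 - t * h5

/-- The `coeffA`, `coeffB`, `coeffC` expression is a positive multiple of product minus square, so
its sign encodes the squared alternative in `Elliptic`. -/
theorem coeff_sub_eq {h : ℝ → ℝ} {t : ℝ} (ht : 0 < t) (ht1 : t ≠ 1) (m : ℝ) :
    coeffA h t + (coeffB h t - coeffC h t) * m = (t - 1) ^ 2 / (2 * t) *
      ((t ^ 2 * deriv (deriv h) t + m) * (t ^ 2 * deriv (deriv h) t + 2 * (t * deriv h t) + m) -
        (2 * (t * deriv h t) / (t - 1) - t ^ 2 * deriv (deriv h) t + m) ^ 2) := by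
  have h1 : t - 1 ≠ 0 := sub_ne_zero.2 ht1
  simp only [coeffA, coeffB, coeffC]
  field_simp
  ring

theorem coeff_add_eq {h : ℝ → ℝ} {t : ℝ} (ht : 0 < t) (m : ℝ) :
    coeffA h t + (coeffB h t + coeffC h t) * m = (t + 1) ^ 2 / (2 * t) *
      ((t ^ 2 * deriv (deriv h) t + m) * (t ^ 2 * deriv (deriv h) t + 2 * (t * deriv h t) + m) -
        (2 * (t * deriv h t) / (t + 1) + t ^ 2 * deriv (deriv h) t - m) ^ 2) := by
  simp only [coeffA, coeffB, coeffC]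
  field_simp
  ring

theorem coeff_sub_nonneg_iff {h : ℝ → ℝ} {t : ℝ} (ht : 0 < t) (ht1 : t ≠ 1) (m : ℝ) :
    (0 ≤ 2 * t / (t - 1) * deriv h t - t ^ 2 * deriv (deriv h) t + m ∨
        0 ≤ coeffA h t + (coeffB h t - coeffC h t) * m) ↔
      (0 ≤ 2 * (t * deriv h t) / (t - 1) - t ^ 2 * deriv (deriv h) t + m ∨
        (2 * (t * deriv h t) / (t - 1) - t ^ 2 * deriv (deriv h) t + m) ^ 2 ≤
          (t ^ 2 * deriv (deriv h) t + m) *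
            (t ^ 2 * deriv (deriv h) t + 2 * (t * deriv h t) + m)) := by
  have h1 : t - 1 ≠ 0 := sub_ne_zero.2 ht1
  have h2 : 0 < (t - 1) ^ 2 / (2 * t) := by positivity
  have h3 : 2 * t / (t - 1) * deriv h t = 2 * (t * deriv h t) / (t - 1) := by ring
  rw [coeff_sub_eq ht ht1, mul_nonneg_iff_of_pos_left h2, sub_nonneg, h3]

theorem coeff_add_nonneg_iff {h : ℝ → ℝ} {t : ℝ} (ht : 0 < t) (m : ℝ) :
    (0 ≤ 2 * t / (t + 1) * deriv h t + t ^ 2 * deriv (deriv h) t - m ∨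
        0 ≤ coeffA h t + (coeffB h t + coeffC h t) * m) ↔
      (0 ≤ 2 * (t * deriv h t) / (t + 1) + t ^ 2 * deriv (deriv h) t - m ∨
        (2 * (t * deriv h t) / (t + 1) + t ^ 2 * deriv (deriv h) t - m) ^ 2 ≤
          (t ^ 2 * deriv (deriv h) t + m) *
            (t ^ 2 * deriv (deriv h) t + 2 * (t * deriv h t) + m)) := by
  have h2 : 0 < (t + 1) ^ 2 / (2 * t) := by positivity
  have h3 : 2 * t / (t + 1) * deriv h t = 2 * (t * deriv h t) / (t + 1) := by ring
  rw [coeff_add_eq ht, mul_nonneg_iff_of_pos_left h2, h3]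
  exact or_congr_right sub_nonneg

theorem coeff_sub_nonneg_inv {h : ℝ → ℝ} (hh : ContDiffOn ℝ 2 h (Ioi 0))
    (hsymm : ∀ t : ℝ, 0 < t → h t = h (1 / t)) {t : ℝ} (ht : 0 < t) (ht1 : t ≠ 1) {m : ℝ}
    (H : 0 ≤ 2 * t / (t - 1) * deriv h t - t ^ 2 * deriv (deriv h) t + m ∨
        0 ≤ coeffA h t + (coeffB h t - coeffC h t) * m) :
    0 ≤ 2 * t⁻¹ / (t⁻¹ - 1) * deriv h t⁻¹ - t⁻¹ ^ 2 * deriv (deriv h) t⁻¹ + m ∨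
        0 ≤ coeffA h t⁻¹ + (coeffB h t⁻¹ - coeffC h t⁻¹) * m := by
  have h1 : t - 1 ≠ 0 := sub_ne_zero.2 ht1
  rw [coeff_sub_nonneg_iff ht ht1] at H
  rw [coeff_sub_nonneg_iff (inv_pos.2 ht) (inv_ne_one.2 ht1), deriv_inv_of_symm hh hsymm ht,
    deriv_deriv_inv_of_symm hh hsymm ht]
  have e1 : 2 * -(t * deriv h t) / (t⁻¹ - 1) = 2 * (t * deriv h t) * t / (t - 1) := by
    have h2 : t⁻¹ - 1 = -(t - 1) / t := by field_simp; ring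
    rw [h2]; field_simp
  have e2 : 2 * -(t * deriv h t) / (t⁻¹ - 1) -
      (t ^ 2 * deriv (deriv h) t + 2 * (t * deriv h t)) + m =
      2 * (t * deriv h t) / (t - 1) - t ^ 2 * deriv (deriv h) t + m := by
    rw [e1]; field_simp; ring
  rw [e2]
  refine H.imp id fun H => H.trans (le_of_eq ?_)
  ring

theorem coeff_add_nonneg_inv {h : ℝ → ℝ} (hh : ContDiffOn ℝ 2 h (Ioi 0))
    (hsymm : ∀ t : ℝ, 0 < t → h t = h (1 / t)) {t : ℝ} (ht : 0 < t) {m : ℝ}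
    (H : 0 ≤ 2 * t / (t + 1) * deriv h t + t ^ 2 * deriv (deriv h) t - m ∨
        0 ≤ coeffA h t + (coeffB h t + coeffC h t) * m) :
    0 ≤ 2 * t⁻¹ / (t⁻¹ + 1) * deriv h t⁻¹ + t⁻¹ ^ 2 * deriv (deriv h) t⁻¹ - m ∨
        0 ≤ coeffA h t⁻¹ + (coeffB h t⁻¹ + coeffC h t⁻¹) * m := by
  rw [coeff_add_nonneg_iff ht] at H
  rw [coeff_add_nonneg_iff (inv_pos.2 ht), deriv_inv_of_symm hh hsymm ht,
    deriv_deriv_inv_of_symm hh hsymm ht]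
  have e2 : 2 * -(t * deriv h t) / (t⁻¹ + 1) +
      (t ^ 2 * deriv (deriv h) t + 2 * (t * deriv h t)) - m =
      2 * (t * deriv h t) / (t + 1) + t ^ 2 * deriv (deriv h) t - m := by
    have h2 : t⁻¹ + 1 = (t + 1) / t := by field_simp; ring
    rw [h2]; field_simp; ring
  rw [e2]
  refine H.imp id fun H => H.trans (le_of_eq ?_)
  ring

theorem continuousAt_deriv_one {u : ℝ → ℝ} (hu : ContDiffOn ℝ 2 u (Ioi 0)) :
    ContinuousAt (deriv u) 1 ∧ ContinuousAt (deriv (deriv u)) 1 := by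
  have h1 := hu.deriv_of_isOpen (m := 1) isOpen_Ioi (by norm_num)
  exact ⟨h1.continuousOn.continuousAt (Ioi_mem_nhds one_pos),
    (h1.continuousOn_deriv_of_isOpen isOpen_Ioi (by norm_num)).continuousAt
      (Ioi_mem_nhds one_pos)⟩

theorem nonneg_one_of_continuousAt {u : ℝ → ℝ} (hu : ContinuousAt u 1)
    (h : ∀ t, 1 < t → 0 ≤ u t) : 0 ≤ u 1 := by
  refine ge_of_tendsto (hu.tendsto.mono_left (nhdsWithin_le_nhds (s := Ioi 1))) ?_
  filter_upwards [self_mem_nhdsWithin] with t ht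
  exact h t ht

theorem forall_pos_of_inv {P : ℝ → Prop} (h1 : P 1) (h : ∀ t, 1 < t → P t)
    (hinv : ∀ t, 1 < t → P t → P t⁻¹) {t : ℝ} (ht : 0 < t) : P t := by
  rcases lt_trichotomy t 1 with hlt | rfl | hgt
  · have h2 := (one_lt_inv₀ ht).2 hlt
    simpa using hinv _ h2 (h _ h2)
  · exact h1
  · exact h t hgt

end VolIso

theorem mainTheorem1
    (W : Matrix (Fin 2) (Fin 2) ℝ → ℝ) (h f : ℝ → ℝ)
    (hW : ContDiffOn ℝ 2 W VolIso.GLp2)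
    (hh : ContDiffOn ℝ 2 h (Set.Ioi 0))
    (hf : ContDiffOn ℝ 2 f (Set.Ioi 0))
    (hsymm : ∀ t : ℝ, 0 < t → h t = h (1 / t))
    (hsplit : ∀ F ∈ VolIso.GLp2,
      W F = h (VolIso.sv₁ F / VolIso.sv₂ F) + f (VolIso.sv₁ F * VolIso.sv₂ F)) :
    VolIso.RankOneConvex W ↔
      (BddBelow (VolIso.sqDerivValues h) ∧ BddBelow (VolIso.sqDerivValues f) ∧
        0 ≤ VolIso.sqDerivInf h + VolIso.sqDerivInf f) ∧
      (∀ t : ℝ, 1 ≤ t → 0 ≤ deriv h t) ∧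
      (∀ t : ℝ, 0 < t → t ≠ 1 →
        0 ≤ 2 * t / (t - 1) * deriv h t - t ^ 2 * deriv (deriv h) t + VolIso.sqDerivInf f ∨
        0 ≤ VolIso.coeffA h t +
          (VolIso.coeffB h t - VolIso.coeffC h t) * VolIso.sqDerivInf f) ∧
      (∀ t : ℝ, 0 < t →
        0 ≤ 2 * t / (t + 1) * deriv h t + t ^ 2 * deriv (deriv h) t - VolIso.sqDerivInf f ∨
        0 ≤ VolIso.coeffA h t +
          (VolIso.coeffB h t + VolIso.coeffC h t) * VolIso.sqDerivInf f) := by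
  open VolIso in
  have hne : ∀ u : ℝ → ℝ, (sqDerivValues u).Nonempty := fun u => nonempty_Ioi.image _
  constructor
  · intro hR
    have hE : ∀ t z : ℝ, 1 < t → 0 < z → Elliptic t (t ^ 2 * deriv (deriv h) t) (t * deriv h t)
        (z ^ 2 * deriv (deriv f) z) := fun t z ht hz => hR.elliptic hW hh hf hsplit ht hz
    obtain ⟨hc1, hc2⟩ := continuousAt_deriv_one hh
    have hsum : ∀ t z : ℝ, 0 < t → 0 < z →
        0 ≤ t ^ 2 * deriv (deriv h) t + z ^ 2 * deriv (deriv f) z := by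
      intro t z ht hz
      refine forall_pos_of_inv (P := fun t => 0 ≤ t ^ 2 * deriv (deriv h) t + _)
        (nonneg_one_of_continuousAt (u := fun t => t ^ 2 * deriv (deriv h) t + _) (by fun_prop)
          fun t ht => (hE t z ht hz).2.1)
        (fun t ht => (hE t z ht hz).2.1) (fun t ht _ => ?_) ht
      rw [deriv_deriv_inv_of_symm hh hsymm (by linarith)]
      exact (hE t z ht hz).2.2.1
    have hbf : BddBelow (sqDerivValues f) := by
      refine ⟨-(1 ^ 2 * deriv (deriv h) 1), ?_⟩
      rintro _ ⟨z, hz, rfl⟩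
      linarith [hsum 1 z one_pos hz]
    have hE0 : ∀ t : ℝ, 1 < t → Elliptic t (t ^ 2 * deriv (deriv h) t) (t * deriv h t)
        (sqDerivInf f) := by
      intro t ht
      -- The infimum need not be attained, but it lies in the closure of the values of `z² f''`.
      refine closure_minimal ?_ (isClosed_setOf_elliptic _ _ _) (csInf_mem_closure (hne f) hbf)
      rintro _ ⟨z, hz, rfl⟩
      exact hE t z ht hz
    refine ⟨⟨?_, hbf, ?_⟩, ?_, ?_, ?_⟩
    · refine ⟨-(1 ^ 2 * deriv (deriv f) 1), ?_⟩
      rintro _ ⟨t, ht, rfl⟩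
      linarith [hsum t 1 ht one_pos]
    · have h1 : -sqDerivInf f ≤ sqDerivInf h := by
        refine le_csInf (hne h) ?_
        rintro _ ⟨t, ht, rfl⟩
        have h2 : -(t ^ 2 * deriv (deriv h) t) ≤ sqDerivInf f := by
          refine le_csInf (hne f) ?_
          rintro _ ⟨z, hz, rfl⟩
          linarith [hsum t z ht hz]
        dsimp only
        linarith
      linarith
    · intro t ht
      rcases ht.eq_or_lt with rfl | ht
      -- Symmetry at `1` reads `h'(1) = -h'(1)`.
      · have h1 := deriv_inv_of_symm hh hsymm one_pos
        simp only [inv_one, one_mul] at h1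
        linarith
      · exact nonneg_of_mul_nonneg_right (hE0 t ht).1 (by linarith)
    · intro t ht
      refine forall_pos_of_inv (P := fun t => t ≠ 1 → _ ∨ _) (fun h => absurd rfl h)
        (fun t ht ht1 => (coeff_sub_nonneg_iff (by linarith) ht1 _).2 (hE0 t ht).2.2.2.1)
        (fun t ht H _ => coeff_sub_nonneg_inv hh hsymm (by linarith) ht.ne' (H ht.ne')) ht
    · intro t ht
      have h4 : ∀ t : ℝ, 1 < t → 0 ≤ 2 * t / (t + 1) * deriv h t + t ^ 2 * deriv (deriv h) t -
          sqDerivInf f ∨ 0 ≤ coeffA h t + (coeffB h t + coeffC h t) * sqDerivInf f :=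
        fun t ht => (coeff_add_nonneg_iff (by linarith) _).2 (hE0 t ht).2.2.2.2
      refine forall_pos_of_inv (P := fun t => _ ∨ _) ?_ h4
        (fun t ht H => coeff_add_nonneg_inv hh hsymm (by linarith) H) ht
      -- Written as the sign of a maximum, the disjunction passes to the limit `t → 1`.
      refine le_max_iff.1 (nonneg_one_of_continuousAt (u := fun t => max
        (2 * t / (t + 1) * deriv h t + t ^ 2 * deriv (deriv h) t - sqDerivInf f)
        (coeffA h t + (coeffB h t + coeffC h t) * sqDerivInf f)) ?_
        fun t ht => le_max_iff.2 (h4 t ht))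
      simp only [coeffA, coeffB, coeffC]
      fun_prop (disch := norm_num)
  · rintro ⟨⟨hbh, hbf, hsum⟩, hmono, h3, h4⟩
    refine rankOneConvex_of_elliptic hW hh hf hsplit fun t z ht hz => ?_
    have ht0 : 0 < t := by linarith
    have hA : ∀ s : ℝ, 0 < s → 0 ≤ s ^ 2 * deriv (deriv h) s + sqDerivInf f := by
      intro s hs
      have h1 : sqDerivInf h ≤ s ^ 2 * deriv (deriv h) s := csInf_le hbh ⟨s, hs, rfl⟩
      linarith
    -- The bound at `1/t` is the condition on `A + 2B`.
    have hA' := hA _ (inv_pos.2 ht0)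
    rw [deriv_deriv_inv_of_symm hh hsymm ht0] at hA'
    have hE0 : Elliptic t (t ^ 2 * deriv (deriv h) t) (t * deriv h t) (sqDerivInf f) :=
      ⟨mul_nonneg ht0.le (hmono t ht.le), hA t ht0, hA',
        (coeff_sub_nonneg_iff ht0 ht.ne' _).1 (h3 t ht0 ht.ne'),
        (coeff_add_nonneg_iff ht0 _).1 (h4 t ht0)⟩
    exact hE0.mono ht (csInf_le hbf ⟨z, hz, rfl⟩)
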